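/- All logarithms are to base $2$. Let $\{0,1\}^*$ be the set of finite binary strings and $\ell(x)$ the length of $x$. Fix a universal prefix computer $U$: a partial recursive function $U(p,y)$ of a program $p\in\{0,1\}^*$ and an input $y$ such that for each $y$ the set of programs $p$ for which $U(p,y)$ is defined is prefix-free, and such that for every other such function $M$ there is a constant $c_M$ so that for each $p$ there is $p'$ with $\ell(p')\le \ell(p)+c_M$ and $U(p',y)=M(p,y)$ for all $y$ for which $M(p,y)$ is defined. Let $K(x)=\min\{\ell(p): U(p)=x\}$ be the prefix Kolmogorov complexity of $x$, where $U(p)$ denotes the computation of $U$ with program $p$ on a fixed trivial input. An ensemble is a probability distribution $\mathbb E$ on $\{0,1\}^*$, with Shannon entropy $H(\mathbb E)=-\sum_x \mathbb E(x)\log\mathbb E(x)$. It is called computable if $H(\mathbb E)<\infty$ and there is a program for $U$ that, given $x\in\{0,1\}^*$ and $m\in\mathbb N$ as input, outputs rational approximations of both $\mathbb E(x)$ and $H(\mathbb E)$ with accuracy at least $2^{-m}$; $K(\mathbb E)$ is the length of a shortest such program, and $\Sigma(\mathbb E)=H(\mathbb E)+K(\mathbb E)$. For $\delta\ge 0$,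 $\mathbb E$ is $\delta$-typical for $x$ if $H(\mathbb E)<\infty$ and $-\log\mathbb E(x)\le H(\mathbb E)(1+\delta)$ (with $-\log 0=\infty$). The coarse effective complexity of $x$ is $$\mathcal E_\delta(x)=\min\{K(\mathbb E)+\Sigma(\mathbb E)-K(x)\;:\;\mathbb E \text{ a computable ensemble that is } \delta\text{-typical for } x\}.$$ Theorem. There is a constant $C\in\mathbb R$ (depending only on $U$) such that for every $\delta\ge 0$ and every sufficiently large $n\in\mathbb N$ (depending on $\delta$) there exists a string $x\in\{0,1\}^n$, for which the minimum above is attained, with $$\mathcal E_\delta(x)\;\ge\;(1-3\delta)\frac n2-(2+3\delta)\log n-2\log\log n+C .$$ -/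

import Mathlib

open Encodable

noncomputable section

namespace EffComplexity

/-- Finite binary strings. -/
abbrev Str : Type := List Bool

/-- A prefix computer with side input: a partial recursive function of a binary program `p` and
an input `y` such that, for every input, the set of halting programs is prefix-free.
Inputs and outputs are finite objects, represented by their natural number codes
(`Encodable.encode`, which is primitive recursive on strings, numbers and pairs). -/
structure IsPrefixMachine (M : Str → ℕ →. ℕ) : Prop where
  partrec : Partrec₂ M
  prefixFree : ∀ (y : ℕ) (p q : Str), (M p y).Dom → (M q y).Dom → p <+: q → p = q

/-- A universal prefix computer: it simulates every prefix computer `M`, on all inputs, with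
programs that are longer by at most a constant depending only on `M`. -/
structure IsUniversalPrefixMachine (U : Str → ℕ →. ℕ) : Prop where
  isPrefixMachine : IsPrefixMachine U
  simulates : ∀ M : Str → ℕ →. ℕ, IsPrefixMachine M →
    ∃ c : ℕ, ∀ p : Str, ∃ p' : Str, p'.length ≤ p.length + c ∧
      ∀ y : ℕ, ∀ z ∈ M p y, z ∈ U p' y

/-- Prefix Kolmogorov complexity `K(x)`: the length of a shortest program that outputs `x`
(on the trivial input `0`). -/
def stringK (U : Str → ℕ →. ℕ) (x : Str) : ℕ :=
  sInf {l : ℕ | ∃ p : Str, p.length = l ∧ encode x ∈ U p 0}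

/-- An ensemble is a probability distribution on the finite binary strings. -/
abbrev Ensemble : Type := PMF Str

/-- The summand `-E(x) log₂ E(x)` of the Shannon entropy (it is `0` if `E(x) = 0`). -/
def entropyTerm (E : Ensemble) (x : Str) : ℝ :=
  -((E x).toReal * Real.logb 2 (E x).toReal)

/-- The Shannon entropy is finite (all its summands are nonnegative). -/
def FiniteEntropy (E : Ensemble) : Prop :=
  Summable (entropyTerm E)

/-- Shannon entropy in bits; meaningful for ensembles with `FiniteEntropy`. -/
def entropy (E : Ensemble) : ℝ :=
  ∑' x, entropyTerm E x

/-- The program `p` computes `E` and `H(E)`: on input `(x, m)` it outputs two rational numbers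
`a / (b + 1)` and `c / (d + 1)` which approximate `E(x)` and `H(E)` with accuracy `2 ^ (-m)`. -/
def ComputesEnsemble (U : Str → ℕ →. ℕ) (p : Str) (E : Ensemble) : Prop :=
  ∀ (x : Str) (m : ℕ), ∃ a b c d : ℕ,
    encode (((a, b), (c, d)) : (ℕ × ℕ) × (ℕ × ℕ)) ∈ U p (encode ((x, m) : Str × ℕ)) ∧
    |(E x).toReal - (a : ℝ) / ((b : ℝ) + 1)| ≤ (1 / 2 : ℝ) ^ m ∧
    |entropy E - (c : ℝ) / ((d : ℝ) + 1)| ≤ (1 / 2 : ℝ) ^ m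

/-- Computable ensembles: the entropy is finite, and probabilities and entropy are computable. -/
def IsComputableEnsemble (U : Str → ℕ →. ℕ) (E : Ensemble) : Prop :=
  FiniteEntropy E ∧ ∃ p : Str, ComputesEnsemble U p E

/-- Kolmogorov complexity `K(E)` of a computable ensemble. -/
def ensembleK (U : Str → ℕ →. ℕ) (E : Ensemble) : ℕ :=
  sInf {l : ℕ | ∃ p : Str, p.length = l ∧ ComputesEnsemble U p E}

/-- Total information `Σ(E) = H(E) + K(E)` of a computable ensemble. -/
def totalInformation (U : Str → ℕ →. ℕ) (E : Ensemble) : ℝ :=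
  entropy E + (ensembleK U E : ℝ)

/-- `E` is `δ`-typical for `x`: `H(E) < ∞` and `-log₂ E(x) ≤ H(E) (1 + δ)`. In particular
`E(x) ≠ 0`, since otherwise `-log₂ E(x) = ∞`. -/
def IsTypical (δ : ℝ) (E : Ensemble) (x : Str) : Prop :=
  FiniteEntropy E ∧ E x ≠ 0 ∧ -Real.logb 2 (E x).toReal ≤ entropy E * (1 + δ)

/-- The values `K(E) + Σ(E) - K(x)` over all computable ensembles `E` that are `δ`-typical
for `x`. -/
def coarseValues (U : Str → ℕ →. ℕ) (δ : ℝ) (x : Str) : Set ℝ :=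
  {v : ℝ | ∃ E : Ensemble, IsComputableEnsemble U E ∧ IsTypical δ E x ∧
    v = (ensembleK U E : ℝ) + totalInformation U E - (stringK U x : ℝ)}

/-- Coarse effective complexity of the string `x`. -/
def coarseEffectiveComplexity (U : Str → ℕ →. ℕ) (δ : ℝ) (x : Str) : ℝ :=
  sInf (coarseValues U δ x)

end EffComplexity

end

namespace EffComplexity

open Nat.Partrec (Code)

/-! ### Primitive recursive enumeration of strings -/

/-! A diagonal argument counts against all short programs at once. Call a string of length `n` heavy
for a program of length `j < n / 2` if the program estimates its probability to be at least about `2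
^ (2 * j - n)`. An ensemble has at most `2 ^ (n - 2 * j - 2)` heavy strings, so the `2 ^ j` programs
of length `j` exclude at most `2 ^ (n - j - 2)` strings, and all `j` together exclude fewer than `2
^ n` (`length_excluded_lt`). Some string `x` therefore survives.

This `x` is simple: it can be found from `n` and the number of short programs that halt on all
relevant inputs, a number below `2 ^ (n / 2)` (`exists_halting_count`). A self-delimiting code gives
`K(x) ≤ n / 2 + 2 log n + O(1)` (`exists_pickMachine`).

Let `E` be typical for `x`. If `K(E) < n / 2`, then `E(x) < 2 ^ (2 * K(E) + 4 - n)`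
(`prob_mul_two_pow_lt`), and typicality turns this into `H(E) ≥ n - 2 * K(E) - 4 - δ * n`
(`le_entropy_of_isTypical`). Otherwise `2 * K(E) ≥ n - 1`. Either way `2 * K(E) + H(E) ≥ n - δ * n -
O(1)`, and subtracting `K(x)` gives slightly more than the claimed bound. -/

theorem primrec_filter {α β : Type*} [Primcodable α] [Primcodable β] {f : α → List β}
    {g : α → β → Bool} (hf : Primrec f) (hg : Primrec₂ g) :
    Primrec fun a => (f a).filter (g a) := by
  have h : Primrec₂ fun a b => bif g a b then some b else none :=
    Primrec.cond hg (Primrec.option_some.comp Primrec.snd) (Primrec.const none)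
  refine (Primrec.listFilterMap hf h).of_eq fun a => ?_
  rw [← List.filterMap_eq_filter]
  congr 1
  funext b
  cases hb : g a b <;> simp [Option.guard, hb]

theorem primrec_two_pow : Primrec fun n : ℕ => 2 ^ n := by
  refine (Primrec.nat_rec₁ (f := fun _ r => r + r) 1
    (Primrec.nat_add.comp Primrec.snd Primrec.snd)).of_eq fun n => ?_
  induction n with
  | zero => rfl
  | succ n ih => rw [pow_succ, ← ih]; ring

/-- The list of all binary strings of length `n`. -/
def strs (n : ℕ) : List Str :=
  Nat.rec [[]] (fun _ l => l.map (List.cons true) ++ l.map (List.cons false)) n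

theorem strs_succ (n : ℕ) :
    strs (n + 1) = (strs n).map (List.cons true) ++ (strs n).map (List.cons false) := rfl

theorem primrec_strs : Primrec strs := by
  have hc : ∀ b : Bool, Primrec₂ fun (_ : ℕ × List Str) (l : Str) => b :: l := fun b =>
    Primrec.list_cons.comp (Primrec.const b) Primrec.snd
  exact Primrec.nat_rec₁ [[]] (Primrec.list_append.comp
    (Primrec.list_map Primrec.snd (hc true)) (Primrec.list_map Primrec.snd (hc false)))

theorem mem_strs {n : ℕ} {x : Str} : x ∈ strs n ↔ x.length = n := by
  induction n generalizing x with
  | zero => simp [strs]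
  | succ n ih =>
    rw [strs_succ]
    rcases x with _ | ⟨_ | _, x⟩ <;> simp [ih]

theorem length_strs (n : ℕ) : (strs n).length = 2 ^ n := by
  induction n with
  | zero => rfl
  | succ n ih => rw [strs_succ]; simp [ih, pow_succ, mul_two]

theorem nodup_strs (n : ℕ) : (strs n).Nodup := by
  induction n with
  | zero => simp [strs]
  | succ n ih =>
    rw [strs_succ, List.nodup_append]
    refine ⟨ih.map fun _ _ h => by simpa using h, ih.map fun _ _ h => by simpa using h, ?_⟩
    simp

/-- The list of all binary strings of length less than `k`. -/
def shortStrs (k : ℕ) : List Str := (List.range k).flatMap strs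

theorem shortStrs_succ (k : ℕ) : shortStrs (k + 1) = shortStrs k ++ strs k := by
  simp [shortStrs, List.range_succ]

theorem mem_shortStrs {k : ℕ} {p : Str} : p ∈ shortStrs k ↔ p.length < k := by
  simp [shortStrs, mem_strs]

theorem primrec_shortStrs : Primrec shortStrs :=
  Primrec.list_flatMap Primrec.list_range (primrec_strs.comp Primrec.snd)

theorem length_shortStrs (k : ℕ) : (shortStrs k).length + 1 = 2 ^ k := by
  induction k with
  | zero => rfl
  | succ k ih => rw [shortStrs_succ, List.length_append, length_strs, pow_succ]; omega

/-- The number with the given binary digits, most significant first. -/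
def val (v : Str) : ℕ := v.foldl (fun a b => 2 * a + b.toNat) 0

theorem primrec_val : Primrec val := by
  have h : Primrec₂ fun (_ : Str) (s : ℕ × Bool) => 2 * s.1 + s.2.toNat :=
    Primrec.nat_add.comp
      (Primrec.nat_mul.comp (Primrec.const 2) (Primrec.fst.comp Primrec.snd))
      ((Primrec.dom_finite Bool.toNat).comp (Primrec.snd.comp Primrec.snd))
  exact Primrec.list_foldl Primrec.id (Primrec.const 0) h

theorem exists_val_eq {k m : ℕ} (h : m < 2 ^ k) : ∃ v : Str, v.length = k ∧ val v = m := by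
  induction k generalizing m with
  | zero => exact ⟨[], rfl, by simp at h; simp [val, h]⟩
  | succ k ih =>
    obtain ⟨v, hv, hm⟩ := ih (m := m / 2) (by rw [pow_succ] at h; omega)
    refine ⟨v ++ [decide (m % 2 = 1)], by simp [hv], ?_⟩
    have : val (v ++ [decide (m % 2 = 1)]) = 2 * val v + (decide (m % 2 = 1)).toNat := by
      simp [val]
    rw [this, hm]
    rcases Nat.mod_two_eq_zero_or_one m with h0 | h0 <;> simp [h0] <;> omega

/-! ### Step-bounded simulation of all short programs -/

/-- The result of `t` steps of the program `p` on the input `(x, n)`. -/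
def run (c : Code) (n t : ℕ) (p x : Str) : Option ℕ :=
  c.evaln t (encode (p, encode (x, n)))

theorem primrec_run (c : Code) :
    Primrec fun a : ((ℕ × ℕ) × Str) × Str => run c a.1.1.1 a.1.1.2 a.1.2 a.2 := by
  have hn : Primrec fun a : ((ℕ × ℕ) × Str) × Str => a.1.1.1 :=
    Primrec.fst.comp (Primrec.fst.comp Primrec.fst)
  have ht : Primrec fun a : ((ℕ × ℕ) × Str) × Str => a.1.1.2 :=
    Primrec.snd.comp (Primrec.fst.comp Primrec.fst)
  have hp : Primrec fun a : ((ℕ × ℕ) × Str) × Str => a.1.2 := Primrec.snd.comp Primrec.fst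
  exact Code.primrec_evaln.comp (Primrec.pair (Primrec.pair ht (Primrec.const c))
    (Primrec.encode.comp (Primrec.pair hp
      (Primrec.encode.comp (Primrec.pair Primrec.snd hn)))))

theorem run_mono {c : Code} {n s t : ℕ} (h : s ≤ t) {p x : Str} {z : ℕ}
    (hz : z ∈ run c n s p x) : z ∈ run c n t p x :=
  Code.evaln_mono h hz

/-- The strings `x` of length `n` for which `p` has not halted on `(x, n)` after `t` steps. -/
def pending (c : Code) (n t : ℕ) (p : Str) : List Str :=
  (strs n).filter fun x => !(run c n t p x).isSome

theorem primrec_pending (c : Code) :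
    Primrec fun a : (ℕ × ℕ) × Str => pending c a.1.1 a.1.2 a.2 :=
  primrec_filter (primrec_strs.comp (Primrec.fst.comp Primrec.fst))
    (Primrec.not.comp (Primrec.option_isSome.comp (primrec_run c)))

/-- The programs of length less than `n / 2` that halt within `t` steps on all inputs `(x, n)`
with `x` of length `n`. -/
def halting (c : Code) (n t : ℕ) : List Str :=
  (shortStrs (n / 2)).filter fun p => decide ((pending c n t p).length = 0)

theorem primrec_halting (c : Code) : Primrec fun a : ℕ × ℕ => halting c a.1 a.2 := by
  have h : PrimrecPred fun a : (ℕ × ℕ) × Str => (pending c a.1.1 a.1.2 a.2).length = 0 :=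
    Primrec.eq.comp (Primrec.list_length.comp (primrec_pending c)) (Primrec.const 0)
  exact primrec_filter
    (primrec_shortStrs.comp (Primrec.nat_div.comp Primrec.fst (Primrec.const 2))) h.decide

theorem mem_halting {c : Code} {n t : ℕ} {p : Str} : p ∈ halting c n t ↔
    p.length < n / 2 ∧ ∀ x : Str, x.length = n → ∃ z, z ∈ run c n t p x := by
  simp only [halting, List.mem_filter, mem_shortStrs, pending,
    List.length_eq_zero_iff, List.filter_eq_nil_iff, Option.mem_def, ← Option.isSome_iff_exists]
  simp [mem_strs, Option.isSome_iff_ne_none]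

theorem mem_halting_mono {c : Code} {n s t : ℕ} (h : s ≤ t) {p : Str} (hp : p ∈ halting c n s) :
    p ∈ halting c n t := by
  rw [mem_halting] at hp ⊢
  exact ⟨hp.1, fun x hx => (hp.2 x hx).imp fun _ => run_mono h⟩

/-- Both lists filter the same enumeration, so equality of lengths will force equality of lists. -/
theorem halting_sublist {c : Code} {n s t : ℕ} (h : s ≤ t) :
    (halting c n s).Sublist (halting c n t) := by
  have : halting c n s = (halting c n t).filter
      fun p => decide ((pending c n s p).length = 0) := by
    rw [halting, halting, List.filter_filter]
    refine List.filter_congr fun p hp => ?_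
    have := @mem_halting_mono c n s t h p
    simp only [halting, List.mem_filter, hp, true_and, decide_eq_true_eq] at this
    grind
  rw [this]
  exact List.filter_sublist

/-- Knowing the number of eventually halting programs, one can recognize a stage at which all of
them have halted. -/
theorem exists_halting_count (c : Code) (n : ℕ) : ∃ N < 2 ^ (n / 2),
    (∃ t, N ≤ (halting c n t).length) ∧
    ∀ t, N ≤ (halting c n t).length → ∀ s, ∀ p ∈ halting c n s, p ∈ halting c n t := by
  have hb : ∀ t, (halting c n t).length < 2 ^ (n / 2) := fun t => by
    have := List.length_filter_le
      (fun p => decide ((pending c n t p).length = 0)) (shortStrs (n / 2))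
    have h2 := length_shortStrs (n / 2)
    simp only [halting]
    omega
  have hbdd : BddAbove (Set.range fun t => (halting c n t).length) :=
    ⟨2 ^ (n / 2), by rintro _ ⟨t, rfl⟩; exact (hb t).le⟩
  obtain ⟨t₀, ht₀⟩ := Nat.sSup_mem (Set.range_nonempty fun t => (halting c n t).length) hbdd
  refine ⟨_, hb t₀, ⟨t₀, le_rfl⟩, fun t ht s p hp => ?_⟩
  have hmax := le_csSup hbdd ⟨max s t, rfl⟩
  -- Stage `t` already has the maximal number of halted programs, so stage `max s t` adds none.
  have heq := (halting_sublist (c := c) (n := n) (le_max_right s t)).eq_of_length_le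
    (by simp only at ht₀ hmax; omega)
  rw [heq]
  exact mem_halting_mono (le_max_left s t) hp

/-! ### Heavy strings and the count of excluded strings -/

/-- The output `o` of a program of length `j` estimates the probability of a string to be at
least `2 ^ (2 * j + 3 - n)`. -/
def isHeavyOutput (n j : ℕ) (o : Option ℕ) : Bool :=
  -- The default has numerator `0`, so a missing or malformed output is never heavy.
  let r := (o.bind (decode (α := (ℕ × ℕ) × (ℕ × ℕ)))).getD ((0, 0), (0, 0))
  decide ((r.1.2 + 1) * 2 ^ (2 * j + 3) ≤ r.1.1 * 2 ^ n)

theorem primrec_isHeavyOutput :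
    Primrec fun a : (ℕ × ℕ) × Option ℕ => isHeavyOutput a.1.1 a.1.2 a.2 := by
  have hr : Primrec fun a : (ℕ × ℕ) × Option ℕ =>
      (a.2.bind (decode (α := (ℕ × ℕ) × (ℕ × ℕ)))).getD ((0, 0), (0, 0)) :=
    Primrec.option_getD.comp
      (Primrec.option_bind Primrec.snd (Primrec.decode.comp Primrec.snd)) (Primrec.const _)
  have ha := Primrec.fst.comp (Primrec.fst.comp hr)
  have hb := Primrec.snd.comp (Primrec.fst.comp hr)
  have hn : Primrec fun a : (ℕ × ℕ) × Option ℕ => a.1.1 := Primrec.fst.comp Primrec.fst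
  have hj : Primrec fun a : (ℕ × ℕ) × Option ℕ => a.1.2 := Primrec.snd.comp Primrec.fst
  have hle := Primrec.nat_le.comp
    (Primrec.nat_mul.comp (Primrec.succ.comp hb)
      (primrec_two_pow.comp (Primrec.nat_add.comp
        (Primrec.nat_mul.comp (Primrec.const 2) hj) (Primrec.const 3))))
    (Primrec.nat_mul.comp ha (primrec_two_pow.comp hn))
  exact hle.decide

/-- The strings of length `n` that get a large probability from the program `p`. -/
def heavy (c : Code) (n t : ℕ) (p : Str) : List Str :=
  (strs n).filter fun x => isHeavyOutput n p.length (run c n t p x)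

theorem primrec_heavy (c : Code) :
    Primrec fun a : (ℕ × ℕ) × Str => heavy c a.1.1 a.1.2 a.2 := by
  refine primrec_filter (primrec_strs.comp (Primrec.fst.comp Primrec.fst)) ?_
  exact primrec_isHeavyOutput.comp (Primrec.pair (Primrec.pair
    (Primrec.fst.comp (Primrec.fst.comp Primrec.fst))
    (Primrec.list_length.comp (Primrec.snd.comp Primrec.fst))) (primrec_run c))

/-- The heavy strings of `p`, provided that there are few of them. -/
def fewHeavy (c : Code) (n t : ℕ) (p : Str) : List Str :=
  -- A halting program need not compute an ensemble. The cutoff keeps the count valid for all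
  -- programs, and programs of genuine ensembles pass it.
  if (heavy c n t p).length * 2 ^ (2 * p.length + 2) ≤ 2 ^ n then heavy c n t p else []

theorem primrec_fewHeavy (c : Code) :
    Primrec fun a : (ℕ × ℕ) × Str => fewHeavy c a.1.1 a.1.2 a.2 := by
  have hle : PrimrecPred fun a : (ℕ × ℕ) × Str =>
      (heavy c a.1.1 a.1.2 a.2).length * 2 ^ (2 * a.2.length + 2) ≤ 2 ^ a.1.1 :=
    Primrec.nat_le.comp
      (Primrec.nat_mul.comp (Primrec.list_length.comp (primrec_heavy c))
        (primrec_two_pow.comp (Primrec.nat_add.comp (Primrec.nat_mul.comp (Primrec.const 2)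
          (Primrec.list_length.comp Primrec.snd)) (Primrec.const 2))))
      (primrec_two_pow.comp (Primrec.fst.comp Primrec.fst))
  exact Primrec.ite hle (primrec_heavy c) (Primrec.const [])

theorem length_fewHeavy_mul_le (c : Code) (n t : ℕ) (p : Str) :
    (fewHeavy c n t p).length * 2 ^ (2 * p.length + 2) ≤ 2 ^ n := by
  unfold fewHeavy
  split_ifs with h
  · exact h
  · simp

/-- The strings that are heavy for some program which has halted. -/
def excluded (c : Code) (n t : ℕ) : List Str :=
  (halting c n t).flatMap (fewHeavy c n t)

theorem primrec_excluded (c : Code) : Primrec fun a : ℕ × ℕ => excluded c a.1 a.2 :=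
  Primrec.list_flatMap (primrec_halting c) (primrec_fewHeavy c)

/-- The first string of length `n` that is not excluded. -/
def pick (c : Code) (n t : ℕ) : Option Str :=
  ((strs n).filter fun x => !decide (x ∈ excluded c n t)).head?

theorem primrec_pick (c : Code) : Primrec fun a : ℕ × ℕ => pick c a.1 a.2 := by
  have hmem : PrimrecRel fun (L : List Str) (x : Str) => x ∈ L :=
    (PrimrecRel.exists_mem_list (Primrec.eq (α := Str))).of_eq fun L x => by simp
  have h : PrimrecPred fun a : (ℕ × ℕ) × Str => a.2 ∈ excluded c a.1.1 a.1.2 :=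
    hmem.comp ((primrec_excluded c).comp Primrec.fst) Primrec.snd
  exact Primrec.list_head?.comp (primrec_filter (primrec_strs.comp Primrec.fst)
    (Primrec.not.comp h.decide))

/-- Length `j` contributes at most `2 ^ j * B / 4 ^ (j + 1) = B / 2 ^ (j + 2)`; the geometric sum
over `j < k` is `(B / 2) * (1 - 2 ^ (-k))`. -/
theorem sum_shortStrs_mul_le {F : Str → ℕ} {B : ℕ}
    (hF : ∀ p, F p * 2 ^ (2 * p.length + 2) ≤ B) (k : ℕ) :
    ((shortStrs k).map F).sum * 2 ^ (k + 1) + B ≤ B * 2 ^ k := by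
  induction k with
  | zero => simp [shortStrs]
  | succ k ih =>
    have hT : ((strs k).map F).sum * 2 ^ (2 * k + 2) ≤ 2 ^ k * B := by
      rw [← List.sum_map_mul_right]
      refine (List.sum_le_card_nsmul _ B ?_).trans ?_
      · simp only [List.mem_map]
        rintro _ ⟨p, hp, rfl⟩
        simpa [mem_strs.1 hp] using hF p
      · simp [length_strs]
    have hT' : ((strs k).map F).sum * 2 ^ (k + 2) ≤ B := by
      refine le_of_mul_le_mul_left (le_trans (le_of_eq ?_) hT) (pow_pos two_pos k)
      ring
    rw [shortStrs_succ, List.map_append, List.sum_append]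
    have e₁ : (((shortStrs k).map F).sum + ((strs k).map F).sum) * 2 ^ (k + 1 + 1) + B + B =
        2 * (((shortStrs k).map F).sum * 2 ^ (k + 1) + B) +
          ((strs k).map F).sum * 2 ^ (k + 2) := by ring
    have e₂ : B * 2 ^ (k + 1) = 2 * (B * 2 ^ k) := by ring
    linarith

theorem length_excluded_lt (c : Code) (n t : ℕ) : (excluded c n t).length < 2 ^ n := by
  have h1 : (excluded c n t).length ≤
      ((shortStrs (n / 2)).map fun p => (fewHeavy c n t p).length).sum := by
    rw [excluded, List.length_flatMap]
    exact (List.filter_sublist.map _).sum_le_sum fun _ _ => Nat.zero_le _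
  have h2 := sum_shortStrs_mul_le (length_fewHeavy_mul_le c n t) (n / 2)
  refine lt_of_le_of_lt h1 ?_
  by_contra! h3
  have h4 : 2 ^ n * 2 ^ (n / 2) ≤
      ((shortStrs (n / 2)).map fun p => (fewHeavy c n t p).length).sum * 2 ^ (n / 2 + 1) :=
    Nat.mul_le_mul h3 (Nat.pow_le_pow_right two_pos (Nat.le_succ _))
  have h5 : 0 < 2 ^ n := pow_pos two_pos n
  omega

theorem exists_mem_pick (c : Code) (n t : ℕ) : ∃ x, x ∈ pick c n t := by
  by_contra! hx
  have h := List.head?_eq_none_iff.1 (Option.eq_none_iff_forall_not_mem.2 hx)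
  have hsub : strs n ⊆ excluded c n t := fun x hx => by
    simpa using List.filter_eq_nil_iff.1 h x hx
  have := ((nodup_strs n).subperm hsub).length_le
  rw [length_strs] at this
  exact absurd (length_excluded_lt c n t) (not_lt.2 this)

theorem of_mem_pick {c : Code} {n t : ℕ} {x : Str} (h : x ∈ pick c n t) :
    x.length = n ∧ x ∉ excluded c n t := by
  simpa [mem_strs] using List.mem_filter.1 (List.mem_of_head? h)

/-! ### A prefix machine producing strings that are not excluded -/

/-- Self-delimiting description of a pair of strings, when the length of the second one can be
computed from the first one. -/
def descr (v q : Str) : Str := v.map (fun _ => true) ++ false :: (v ++ q)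

theorem length_descr (v q : Str) : (descr v q).length = 2 * v.length + 1 + q.length := by
  simp [descr]; ring

/-- The unary block ended by `false` fixes the length of `v`, hence where `q` begins. -/
theorem of_descr_prefix {v q v' q' : Str} (h : descr v q <+: descr v' q') :
    v = v' ∧ q <+: q' := by
  have key : ∀ (a b : Str) (r r' : Str),
      a.map (fun _ => true) ++ false :: r <+: b.map (fun _ => true) ++ false :: r' →
      a.length = b.length ∧ r <+: r' := by
    intro a
    induction a with
    | nil => rintro (_ | ⟨_, b⟩) r r' h <;> simp_all
    | cons _ a ih =>
      rintro (_ | ⟨_, b⟩) r r' h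
      · simp at h
      · simpa using ih b r r' (by simpa using h)
  obtain ⟨hl, s, hs⟩ := key _ _ _ _ h
  rw [List.append_assoc] at hs
  obtain ⟨h1, h2⟩ := List.append_inj hs hl
  exact ⟨h1, s, h2⟩

/-- One step of the search: `w` proposes a parsing of the program and a number of steps. -/
def pickStage (c : Code) (p : Str) (w : ℕ) : Option ℕ :=
  (decode (α := (Str × Str) × ℕ) w).bind fun a =>
    if p = descr a.1.1 a.1.2 ∧ a.1.2.length = val a.1.1 / 2 ∧
        val a.1.2 ≤ (halting c (val a.1.1) a.2).length then
      (pick c (val a.1.1) a.2).map encode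
    else none

theorem primrec_pickStage (c : Code) : Primrec₂ (pickStage c) := by
  have hv : Primrec fun b : (Str × ℕ) × ((Str × Str) × ℕ) => b.2.1.1 :=
    Primrec.fst.comp (Primrec.fst.comp Primrec.snd)
  have hq : Primrec fun b : (Str × ℕ) × ((Str × Str) × ℕ) => b.2.1.2 :=
    Primrec.snd.comp (Primrec.fst.comp Primrec.snd)
  have ht : Primrec fun b : (Str × ℕ) × ((Str × Str) × ℕ) => b.2.2 :=
    Primrec.snd.comp Primrec.snd
  have hd : Primrec fun b : (Str × ℕ) × ((Str × Str) × ℕ) => descr b.2.1.1 b.2.1.2 :=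
    Primrec.list_append.comp (Primrec.list_map hv (Primrec₂.const true))
      (Primrec.list_cons.comp (Primrec.const false) (Primrec.list_append.comp hv hq))
  have hn := primrec_val.comp hv
  have hc := (Primrec.eq.comp (Primrec.fst.comp Primrec.fst) hd).and
    ((Primrec.eq.comp (Primrec.list_length.comp hq)
      (Primrec.nat_div.comp hn (Primrec.const 2))).and
    (Primrec.nat_le.comp (primrec_val.comp hq)
      (Primrec.list_length.comp ((primrec_halting c).comp (Primrec.pair hn ht)))))
  have hp := Primrec.option_map ((primrec_pick c).comp (Primrec.pair hn ht))
    (Primrec.encode.comp Primrec.snd).to₂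
  exact Primrec.option_bind (Primrec.decode.comp Primrec.snd)
    (Primrec.ite hc hp (Primrec.const none))

theorem mem_pickStage {c : Code} {p : Str} {w z : ℕ} (h : z ∈ pickStage c p w) :
    ∃ (v q : Str) (t : ℕ) (x : Str), p = descr v q ∧ q.length = val v / 2 ∧
      val q ≤ (halting c (val v) t).length ∧ x ∈ pick c (val v) t ∧ encode x = z := by
  simp only [pickStage, Option.mem_def, Option.bind_eq_some_iff] at h
  obtain ⟨⟨⟨v, q⟩, t⟩, -, h⟩ := h
  split_ifs at h with hc
  obtain ⟨x, hx, rfl⟩ := Option.map_eq_some_iff.1 h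
  exact ⟨v, q, t, x, hc.1, hc.2.1, hc.2.2, hx, rfl⟩

/-- The prefix machine that searches for a string which is not excluded. -/
def pickMachine (c : Code) (p : Str) (_y : ℕ) : Part ℕ := Nat.rfindOpt (pickStage c p)

theorem isPrefixMachine_pickMachine (c : Code) : IsPrefixMachine (pickMachine c) where
  partrec := Partrec.rfindOpt
    ((primrec_pickStage c).to_comp.comp (Computable.fst.comp Computable.fst) Computable.snd)
  prefixFree := by
    intro y p p' h h' hpp
    obtain ⟨w, z, hz⟩ := Nat.rfindOpt_dom.1 h
    obtain ⟨w', z', hz'⟩ := Nat.rfindOpt_dom.1 h'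
    obtain ⟨v, q, -, -, rfl, hq, -⟩ := mem_pickStage hz
    obtain ⟨v', q', -, -, rfl, hq', -⟩ := mem_pickStage hz'
    obtain ⟨rfl, hs⟩ := of_descr_prefix hpp
    rw [hs.eq_of_length (hq.trans hq'.symm)]

/-- There is a string of length `n` with a short description that is not excluded at a stage at
which all programs that eventually halt have halted. -/
theorem exists_pickMachine (c : Code) {n L : ℕ} (hn : n < 2 ^ L) : ∃ (p x : Str) (t : ℕ),
    p.length = 2 * L + 1 + n / 2 ∧ (∀ y, encode x ∈ pickMachine c p y) ∧ x.length = n ∧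
      x ∉ excluded c n t ∧ ∀ s, ∀ r ∈ halting c n s, r ∈ halting c n t := by
  obtain ⟨v, hvL, rfl⟩ := exists_val_eq hn
  obtain ⟨N, hN, ⟨t₀, ht₀⟩, hall⟩ := exists_halting_count c (val v)
  obtain ⟨q, hqk, rfl⟩ := exists_val_eq hN
  have hdom : (pickMachine c (descr v q) 0).Dom := by
    refine Nat.rfindOpt_dom.2 ?_
    obtain ⟨x, hx⟩ := exists_mem_pick c (val v) t₀
    refine ⟨encode ((v, q), t₀), encode x, ?_⟩
    have hx' : pick c (val v) t₀ = some x := hx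
    simp [pickStage, hqk, ht₀, hx']
  obtain ⟨z, hz⟩ := Part.dom_iff_mem.1 hdom
  obtain ⟨w, hw⟩ := Nat.rfindOpt_spec hz
  obtain ⟨v', q', t, x, hd, -, hval, hx, rfl⟩ := mem_pickStage hw
  -- The stage `t` found by the search may differ from `t₀`; any stage passing the count test
  -- serves. Equal descriptions are prefixes of each other, which identifies both components.
  obtain ⟨rfl, hs⟩ := of_descr_prefix (hd ▸ List.prefix_rfl : descr v q <+: descr v' q')
  obtain ⟨-, hs'⟩ := of_descr_prefix (hd ▸ List.prefix_rfl : descr v q' <+: descr v q)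
  obtain rfl := hs.eq_of_length_le hs'.length_le
  exact ⟨descr v q, x, t, by rw [length_descr, hvL, hqk], fun _ => hz, (of_mem_pick hx).1,
    (of_mem_pick hx).2, fun s r hr => hall t hval s r hr⟩

/-! ### Ensembles computed by short programs -/

theorem exists_code_of_partrec {U : Str → ℕ →. ℕ} (h : Partrec₂ U) :
    ∃ c : Code, ∀ p y z, z ∈ c.eval (encode (p, y)) ↔ z ∈ U p y := by
  obtain ⟨c, hc⟩ := Code.exists_code.1 h
  refine ⟨c, fun p y z => ?_⟩
  rw [hc]
  simp

theorem entropyTerm_nonneg (E : Ensemble) (x : Str) : 0 ≤ entropyTerm E x := by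
  have h1 : (E x).toReal ≤ 1 := ENNReal.toReal_le_of_le_ofReal zero_le_one
    (by simpa using E.coe_le_one x)
  have h2 := Real.logb_nonpos one_lt_two ENNReal.toReal_nonneg h1
  have h3 : 0 ≤ (E x).toReal := ENNReal.toReal_nonneg
  unfold entropyTerm
  nlinarith [mul_nonneg h3 (neg_nonneg.2 h2)]

theorem entropy_nonneg (E : Ensemble) : 0 ≤ entropy E :=
  tsum_nonneg (entropyTerm_nonneg E)

theorem card_mul_le_one_of_le (E : Ensemble) {ε : ℝ} (S : Finset Str)
    (h : ∀ x ∈ S, ε ≤ (E x).toReal) : S.card * ε ≤ 1 := by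
  calc S.card * ε = ∑ _x ∈ S, ε := by simp
    _ ≤ ∑ x ∈ S, (E x).toReal := Finset.sum_le_sum h
    _ = (∑ x ∈ S, E x).toReal := (ENNReal.toReal_sum fun x _ => E.apply_ne_top x).symm
    _ ≤ 1 := ENNReal.toReal_le_of_le_ofReal zero_le_one
      (by simpa using (ENNReal.sum_le_tsum S).trans E.tsum_coe.le)

/-- Scaled by `2 ^ n`, the error is at most `1`, which is absorbed by the gaps between `4 * 4 ^ j`,
the threshold `8 * 4 ^ j` and `16 * 4 ^ j`. -/
theorem isHeavyOutput_of_approx {n j a b c d z : ℕ} {e : ℝ} {o : Option ℕ} (ho : z ∈ o)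
    (hz : z = encode (((a, b), (c, d)) : (ℕ × ℕ) × (ℕ × ℕ)))
    (he : |e - (a : ℝ) / ((b : ℝ) + 1)| ≤ (1 / 2 : ℝ) ^ n) :
    (isHeavyOutput n j o = true → 2 ^ (2 * j + 2) ≤ e * 2 ^ n) ∧
    (isHeavyOutput n j o = false → e * 2 ^ n < 2 ^ (2 * j + 4)) := by
  obtain rfl : o = some z := ho
  have hb : (0 : ℝ) < (b : ℝ) + 1 := by positivity
  have h2 : (0 : ℝ) < 2 ^ n := by positivity
  have hr : isHeavyOutput n j (some z) = decide ((b + 1) * 2 ^ (2 * j + 3) ≤ a * 2 ^ n) := by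
    subst hz
    simp only [isHeavyOutput, Option.bind_some, encodek, Option.getD_some]
  have hiff : (b + 1) * 2 ^ (2 * j + 3) ≤ a * 2 ^ n ↔
      (2 : ℝ) ^ (2 * j + 3) ≤ (a : ℝ) / ((b : ℝ) + 1) * 2 ^ n := by
    rw [div_mul_eq_mul_div, le_div_iff₀ hb, mul_comm ((2 : ℝ) ^ (2 * j + 3))]
    exact_mod_cast Iff.rfl
  have hone : (1 / 2 : ℝ) ^ n * 2 ^ n = 1 := by rw [← mul_pow]; norm_num
  obtain ⟨hl, hu⟩ := abs_le.1 he
  have hl' := mul_le_mul_of_nonneg_right hl h2.le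
  have hu' := mul_le_mul_of_nonneg_right hu h2.le
  rw [neg_mul, hone, sub_mul] at hl'
  rw [hone, sub_mul] at hu'
  have hpow : (1 : ℝ) ≤ 2 ^ (2 * j) := one_le_pow₀ one_le_two
  have e2 : (2 : ℝ) ^ (2 * j + 2) = 4 * 2 ^ (2 * j) := by ring
  have e3 : (2 : ℝ) ^ (2 * j + 3) = 8 * 2 ^ (2 * j) := by ring
  have e4 : (2 : ℝ) ^ (2 * j + 4) = 16 * 2 ^ (2 * j) := by ring
  rw [hr]
  constructor
  · intro h
    have := hiff.1 (of_decide_eq_true h)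
    linarith
  · intro h
    have := not_le.1 (mt hiff.2 (of_decide_eq_false h))
    linarith

/-- A program that halts on finitely many inputs halts on them within a common number of steps. -/
theorem exists_mem_halting {c : Code} {n : ℕ} {p : Str} (hp : p.length < n / 2)
    (h : ∀ x : Str, x.length = n → ∃ z, z ∈ c.eval (encode (p, encode (x, n)))) :
    ∃ s, p ∈ halting c n s := by
  have h' : ∀ x : Str, ∃ t, x.length = n → ∃ z, z ∈ run c n t p x := fun x => by
    by_cases hx : x.length = n
    · obtain ⟨z, hz⟩ := h x hx
      obtain ⟨t, ht⟩ := Code.evaln_complete.1 hz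
      exact ⟨t, fun _ => ⟨z, ht⟩⟩
    · exact ⟨0, fun hx' => absurd hx' hx⟩
  choose T hT using h'
  refine ⟨(strs n).toFinset.sup T, mem_halting.2 ⟨hp, fun x hx => ?_⟩⟩
  obtain ⟨z, hz⟩ := hT x hx
  exact ⟨z, run_mono (Finset.le_sup (by simpa [mem_strs] using hx)) hz⟩

/-- A string that is not excluded has small probability in all ensembles with a short program. -/
theorem prob_mul_two_pow_lt {U : Str → ℕ →. ℕ} {c : Code}
    (hc : ∀ p y z, z ∈ c.eval (encode (p, y)) ↔ z ∈ U p y) {n t : ℕ} {x : Str}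
    (hx : x.length = n) (hex : x ∉ excluded c n t)
    (hall : ∀ s, ∀ r ∈ halting c n s, r ∈ halting c n t) {p : Str} (hp : p.length < n / 2)
    {E : Ensemble} (hE : ComputesEnsemble U p E) :
    (E x).toReal * 2 ^ n < 2 ^ (2 * p.length + 4) := by
  have hmem : p ∈ halting c n t := by
    obtain ⟨s, hs⟩ := exists_mem_halting (c := c) hp fun y _ => by
      obtain ⟨a, b, c', d, h, -⟩ := hE y n
      exact ⟨_, (hc _ _ _).2 h⟩
    exact hall s p hs
  have hkey : ∀ y : Str, y.length = n →
      (isHeavyOutput n p.length (run c n t p y) = true →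
        2 ^ (2 * p.length + 2) ≤ (E y).toReal * 2 ^ n) ∧
      (isHeavyOutput n p.length (run c n t p y) = false →
        (E y).toReal * 2 ^ n < 2 ^ (2 * p.length + 4)) := fun y hy => by
    obtain ⟨z, hz⟩ := (mem_halting.1 hmem).2 y hy
    obtain ⟨a, b, c', d, h, happ, -⟩ := hE y n
    exact isHeavyOutput_of_approx hz
      (Part.mem_unique ((hc _ _ _).1 (Code.evaln_sound hz)) h) happ
  -- Total mass `1` bounds the number of heavy strings, so the cutoff in `fewHeavy` is inactive for
  -- `p`.
  have hfew : (heavy c n t p).length * 2 ^ (2 * p.length + 2) ≤ 2 ^ n := by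
    have h2 : (0 : ℝ) < 2 ^ n := by positivity
    have := card_mul_le_one_of_le E (ε := 2 ^ (2 * p.length + 2) / 2 ^ n)
      (heavy c n t p).toFinset fun y hy => by
        have hy' := List.mem_filter.1 (List.mem_toFinset.1 hy)
        rw [div_le_iff₀ h2]
        exact (hkey y (mem_strs.1 hy'.1)).1 hy'.2
    have hnodup : (heavy c n t p).Nodup := (nodup_strs n).filter _
    rw [List.toFinset_card_of_nodup hnodup, mul_div_assoc', div_le_one h2] at this
    exact_mod_cast this
  refine (hkey x hx).2 (Bool.eq_false_iff.2 fun hh => hex ?_)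
  refine List.mem_flatMap.2 ⟨p, hmem, ?_⟩
  rw [fewHeavy, if_pos hfew]
  exact List.mem_filter.2 ⟨mem_strs.2 hx, hh⟩

/-! ### The minimum is attained -/

theorem ComputesEnsemble.unique {U : Str → ℕ →. ℕ} {p : Str} {E E' : Ensemble}
    (h : ComputesEnsemble U p E) (h' : ComputesEnsemble U p E') : E = E' := by
  refine PMF.ext fun x => ?_
  rw [← ENNReal.toReal_eq_toReal_iff' (E.apply_ne_top x) (E'.apply_ne_top x)]
  by_contra hne
  have hpos : 0 < |(E x).toReal - (E' x).toReal| / 2 := by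
    have := abs_pos.2 (sub_ne_zero.2 hne)
    positivity
  obtain ⟨m, hm⟩ := exists_pow_lt_of_lt_one hpos (by norm_num : (1 / 2 : ℝ) < 1)
  obtain ⟨a, b, c, d, hz, he, -⟩ := h x m
  obtain ⟨a', b', c', d', hz', he', -⟩ := h' x m
  have := encode_injective (Part.mem_unique hz hz')
  simp only [Prod.mk.injEq] at this
  obtain ⟨⟨rfl, rfl⟩, -⟩ := this
  rw [abs_sub_comm] at he'
  have := abs_sub_le (E x).toReal ((a : ℝ) / ((b : ℝ) + 1)) (E' x).toReal
  linarith

theorem IsComputableEnsemble.exists_program {U : Str → ℕ →. ℕ} {E : Ensemble}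
    (h : IsComputableEnsemble U E) :
    ∃ p : Str, p.length = ensembleK U E ∧ ComputesEnsemble U p E :=
  Nat.sInf_mem (s := {l : ℕ | ∃ p : Str, p.length = l ∧ ComputesEnsemble U p E})
    (h.2.imp' List.length fun p hp => ⟨p, rfl, hp⟩)

theorem finite_setOf_ensembleK_le (U : Str → ℕ →. ℕ) (B : ℕ) :
    {E : Ensemble | IsComputableEnsemble U E ∧ ensembleK U E ≤ B}.Finite := by
  refine ((List.finite_length_le Bool B).biUnion fun p _ =>
    (Set.Subsingleton.finite (s := {E | ComputesEnsemble U p E})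
      fun _ h _ h' => h.unique h')).subset ?_
  rintro E ⟨hE, hB⟩
  obtain ⟨p, hp, hpE⟩ := hE.exists_program
  exact Set.mem_biUnion (x := p) (hp.trans_le hB) hpE

/-- The machine that, without a program, computes the point mass at `x`. -/
def pointMassMachine (x : Str) (p : Str) (y : ℕ) : Part ℕ :=
  ((if p = [] then
      if (decode (α := Str × ℕ) y).map Prod.fst = some x then
        some (encode (((1, 0), (0, 0)) : (ℕ × ℕ) × (ℕ × ℕ)))
      else some (encode (((0, 0), (0, 0)) : (ℕ × ℕ) × (ℕ × ℕ)))
    else none : Option ℕ) : Part ℕ)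

theorem isPrefixMachine_pointMassMachine (x : Str) : IsPrefixMachine (pointMassMachine x) where
  partrec := by
    refine Computable.ofOption (Primrec.to_comp ?_)
    refine Primrec.ite (Primrec.eq.comp Primrec.fst (Primrec.const []))
      (Primrec.ite (Primrec.eq.comp (Primrec.option_map (Primrec.decode.comp Primrec.snd)
        (Primrec.fst.comp Primrec.snd).to₂) (Primrec.const (some x)))
        (Primrec.const _) (Primrec.const _)) (Primrec.const _)
  prefixFree := by
    have : ∀ p y, (pointMassMachine x p y).Dom → p = [] := fun p y h => by
      by_contra hp
      simp [pointMassMachine, hp] at h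
    intro y p q hp hq _
    rw [this p y hp, this q y hq]

theorem entropyTerm_pure (x y : Str) : entropyTerm (PMF.pure x) y = 0 := by
  by_cases h : y = x <;> simp [entropyTerm, h]

theorem isComputableEnsemble_pure {U : Str → ℕ →. ℕ} (hU : IsUniversalPrefixMachine U) (x : Str) :
    IsComputableEnsemble U (PMF.pure x) := by
  refine ⟨by simp [FiniteEntropy, funext (entropyTerm_pure x)], ?_⟩
  obtain ⟨_, h⟩ := hU.simulates _ (isPrefixMachine_pointMassMachine x)
  obtain ⟨p, -, hp⟩ := h []
  have hH : entropy (PMF.pure x) = 0 := by simp [entropy, entropyTerm_pure]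
  refine ⟨p, fun y m => ?_⟩
  by_cases hy : y = x
  · refine ⟨1, 0, 0, 0, hp _ _ (by simp [pointMassMachine, hy]), ?_, ?_⟩ <;> simp [hH, hy]
  · refine ⟨0, 0, 0, 0, hp _ _ (by simp [pointMassMachine, hy]), ?_, ?_⟩ <;> simp [hH, hy]

theorem isTypical_pure (δ : ℝ) (x : Str) : IsTypical δ (PMF.pure x) x :=
  ⟨by simp [FiniteEntropy, funext (entropyTerm_pure x)], by simp,
    by simp [entropy, entropyTerm_pure]⟩

/-- The point mass at `x` makes the set nonempty. Since entropy is nonnegative, a bound on the value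
bounds `K(E)`, and each program computes at most one ensemble, so only finitely many values lie
below a given one. -/
theorem isLeast_coarseEffectiveComplexity {U : Str → ℕ →. ℕ} (hU : IsUniversalPrefixMachine U)
    (δ : ℝ) (x : Str) :
    IsLeast (coarseValues U δ x) (coarseEffectiveComplexity U δ x) := by
  obtain ⟨v₀, hv₀⟩ : (coarseValues U δ x).Nonempty :=
    ⟨_, PMF.pure x, isComputableEnsemble_pure hU x, isTypical_pure δ x, rfl⟩
  have hfin : (coarseValues U δ x ∩ Set.Iic v₀).Finite := by
    refine ((finite_setOf_ensembleK_le U ⌈v₀ + stringK U x⌉₊).image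
      fun E => (ensembleK U E : ℝ) + totalInformation U E - (stringK U x : ℝ)).subset ?_
    rintro _ ⟨⟨E, hE, -, rfl⟩, hle⟩
    refine ⟨E, ⟨hE, ?_⟩, rfl⟩
    have h0 := entropy_nonneg E
    have h1 : (0 : ℝ) ≤ ensembleK U E := Nat.cast_nonneg _
    simp only [Set.mem_Iic, totalInformation] at hle
    have h2 : (ensembleK U E : ℝ) ≤ v₀ + stringK U x := by linarith
    exact_mod_cast h2.trans (Nat.le_ceil _)
  obtain ⟨v, ⟨hv, hvv₀⟩, hmin⟩ := Set.exists_min_image _ id hfin ⟨v₀, hv₀, le_refl v₀⟩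
  have hleast : IsLeast (coarseValues U δ x) v := by
    refine ⟨hv, fun w hw => ?_⟩
    rcases le_total w v₀ with h | h
    · exact hmin w ⟨hw, h⟩
    · exact le_trans hvv₀ h
  rw [coarseEffectiveComplexity, hleast.csInf_eq]
  exact hleast

/-! ### The lower bound -/

theorem le_entropy_of_isTypical {δ : ℝ} (hδ : 0 ≤ δ) {E : Ensemble} {x : Str}
    (h : IsTypical δ E x) {n j : ℕ} (hE : (E x).toReal * 2 ^ n < 2 ^ (2 * j + 4)) :
    (n : ℝ) - 2 * j - 4 - δ * n ≤ entropy E := by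
  obtain ⟨-, h0, hlog⟩ := h
  have hpos : 0 < (E x).toReal := ENNReal.toReal_pos h0 (E.apply_ne_top x)
  have hl := Real.logb_lt_logb one_lt_two (by positivity) hE
  rw [Real.logb_mul hpos.ne' (by positivity), Real.logb_pow, Real.logb_pow,
    Real.logb_self_eq_one one_lt_two] at hl
  push_cast at hl
  have hH := entropy_nonneg E
  have hn : (0 : ℝ) ≤ n := Nat.cast_nonneg n
  have hj : (0 : ℝ) ≤ j := Nat.cast_nonneg j
  -- If `H(E) ≤ n`, the typicality loss `δ * H(E)` is at most `δ * n`; if `H(E) ≥ n`, the bound is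
  -- immediate.
  rcases le_total (entropy E) n with hc | hc
  · nlinarith [mul_le_mul_of_nonneg_left hc hδ]
  · nlinarith [mul_nonneg hδ hn]

/-- Some string of length `n` has complexity at most about `n / 2`, but small probability in all
ensembles whose complexity is less than `n / 2`. -/
theorem exists_nonstochastic_string {U : Str → ℕ →. ℕ} (hU : IsUniversalPrefixMachine U) :
    ∃ c : ℕ, ∀ n L : ℕ, n < 2 ^ L → ∃ x : Str, x.length = n ∧
      stringK U x ≤ 2 * L + 1 + n / 2 + c ∧
      ∀ (p : Str) (E : Ensemble), p.length < n / 2 → ComputesEnsemble U p E →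
        (E x).toReal * 2 ^ n < 2 ^ (2 * p.length + 4) := by
  obtain ⟨c, hc⟩ := exists_code_of_partrec hU.isPrefixMachine.partrec
  obtain ⟨d, hd⟩ := hU.simulates _ (isPrefixMachine_pickMachine c)
  refine ⟨d, fun n L hn => ?_⟩
  obtain ⟨p, x, t, hpl, hpx, hx, hex, hall⟩ := exists_pickMachine c hn
  obtain ⟨p', hp', hs⟩ := hd p
  refine ⟨x, hx, ?_, fun p E hp hE => prob_mul_two_pow_lt hc hx hex hall hp hE⟩
  have hK : stringK U x ≤ p'.length := Nat.sInf_le ⟨p', rfl, hs 0 _ (hpx 0)⟩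
  exact hK.trans (hpl ▸ hp')

end EffComplexity

/-- The first conjunct records that the minimum defining the coarse effective complexity of `x`
is attained, so that the lower bound is about a genuine minimum. -/
theorem mainTheorem3 (U : EffComplexity.Str → ℕ →. ℕ)
    (hU : EffComplexity.IsUniversalPrefixMachine U) :
    ∃ C : ℝ, ∀ δ : ℝ, 0 ≤ δ → ∃ N : ℕ, ∀ n : ℕ, N ≤ n →
      ∃ x : EffComplexity.Str, x.length = n ∧
        IsLeast (EffComplexity.coarseValues U δ x)
          (EffComplexity.coarseEffectiveComplexity U δ x) ∧
        (1 - 3 * δ) * ((n : ℝ) / 2) - (2 + 3 * δ) * Real.logb 2 (n : ℝ)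
            - 2 * Real.logb 2 (Real.logb 2 (n : ℝ)) + C
          ≤ EffComplexity.coarseEffectiveComplexity U δ x := by
  open EffComplexity in
  obtain ⟨c, hc⟩ := exists_nonstochastic_string hU
  -- The `7` is `4` from the entropy bound plus `3` from `K(x)`, as `2 * (log n + 1) + 1 = 2 * log n
  -- + 3`. From `n = 2` on, `log log n ≥ 0`, so that term can be dropped.
  refine ⟨-(c : ℝ) - 7, fun δ hδ => ⟨2, fun n hn => ?_⟩⟩
  obtain ⟨x, hx, hK, hprob⟩ := hc n (Nat.log 2 n + 1) (Nat.lt_pow_succ_log_self one_lt_two n)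
  have hleast := isLeast_coarseEffectiveComplexity hU δ x
  refine ⟨x, hx, hleast, ?_⟩
  obtain ⟨E, hE, htyp, hv⟩ := hleast.1
  rw [hv, totalInformation]
  obtain ⟨p, hp, hpE⟩ := hE.exists_program
  have hlog : (Nat.log 2 n : ℝ) ≤ Real.logb 2 n := by
    exact_mod_cast Real.natLog_le_logb n 2
  have hn2 : (2 : ℝ) ≤ n := by exact_mod_cast hn
  have hlog1 : 1 ≤ Real.logb 2 (n : ℝ) := by
    rw [Real.le_logb_iff_rpow_le one_lt_two (by linarith)]
    simpa using hn2
  have hloglog : 0 ≤ Real.logb 2 (Real.logb 2 (n : ℝ)) := Real.logb_nonneg one_lt_two hlog1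
  have hKR : (stringK U x : ℝ) ≤ 2 * (Nat.log 2 n + 1) + 1 + (n / 2 : ℕ) + c := by
    exact_mod_cast hK
  have hhalf : ((n / 2 : ℕ) : ℝ) ≤ n / 2 := Nat.cast_div_le
  have hδn : 0 ≤ δ * n := by positivity
  have hδlog : 0 ≤ δ * Real.logb 2 (n : ℝ) := mul_nonneg hδ (by linarith)
  rcases lt_or_ge p.length (n / 2) with hlt | hge
  · have hH := le_entropy_of_isTypical hδ htyp (hprob p E hlt hpE)
    rw [hp] at hH
    linarith
  · have hH := entropy_nonneg E
    have hge' : ((n / 2 : ℕ) : ℝ) ≤ ensembleK U E := by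
      rw [hp] at hge
      exact_mod_cast hge
    have hhalf' : (n : ℝ) / 2 - 1 ≤ (n / 2 : ℕ) := by
      have : (n : ℝ) ≤ 2 * (n / 2 : ℕ) + 1 := by exact_mod_cast (by omega : n ≤ 2 * (n / 2) + 1)
      linarith
    linarith
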